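/- Let $K$ be a field and let $n, s$ be integers with $1 < s < n$. Write $\mathbb{A}^n = \operatorname{Spec} K[x_1,\ldots,x_n]$, let $$I = \bigcap_{i=1}^{s} (x_1,\ldots,\widehat{x_i},\ldots,x_n)$$ be the reduced ideal of the union of the first $s$ coordinate axes of $\mathbb{A}^n$, and let $\mathfrak{m} = (x_1,\ldots,x_n)$ be the ideal of the origin. Call an ideal $J$ of $K[x_1,\ldots,x_n]$ that is generated by monomials *tame* if the blowup $\operatorname{Proj}\bigl(\bigoplus_{k \ge 0} J^k\bigr)$ of $\mathbb{A}^n$ with center $J$ is smooth over $K$. Then the ideal $R = I \cap \mathfrak{m}^3$ is a tame monomial ideal: the blowup of $\mathbb{A}^n$ with center $R$ is smooth over $K$. Moreover $R$ has the same zero set as $I$, that is, $V(R) = V(I)$ in $\mathbb{A}^n$, and $\sqrt{R} = I$. -/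

import Mathlib

open AlgebraicGeometry CategoryTheory

universe u

/-! ### The blowup of an affine scheme in an ideal -/

/-- The degree `i` part `I ^ i t ^ i` of the Rees algebra `⨁ i, I ^ i t ^ i` of an ideal `I`. -/
def reesGrading {R : Type u} [CommRing R] (I : Ideal R) (i : ℕ) :
    Submodule R (reesAlgebra I) where
  carrier := {f | ∀ j, j ≠ i → (f : Polynomial R).coeff j = 0}
  add_mem' {f g} hf hg j hj := by simp [hf j hj, hg j hj]
  zero_mem' j _ := by simp
  smul_mem' r f hf j hj := by simp [hf j hj]

theorem reesGrading_eq_monomial {R : Type u} [CommRing R] {I : Ideal R} {i : ℕ}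
    {f : reesAlgebra I} (hf : f ∈ reesGrading I i) :
    (f : Polynomial R) = Polynomial.monomial i ((f : Polynomial R).coeff i) := by
  ext j
  rw [Polynomial.coeff_monomial]
  split_ifs with h
  · rw [h]
  · exact hf j (Ne.symm h)

/-- The component of degree `i` of an element of the Rees algebra. -/
noncomputable def reesComponent {R : Type u} [CommRing R] {I : Ideal R}
    (f : reesAlgebra I) (i : ℕ) : reesGrading I i :=
  ⟨⟨Polynomial.monomial i ((f : Polynomial R).coeff i), reesAlgebra.monomial_mem.2 (f.2 i)⟩,
    fun _ hj => Polynomial.coeff_monomial_of_ne _ hj⟩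

instance reesGrading_gradedMonoid {R : Type u} [CommRing R] (I : Ideal R) :
    SetLike.GradedMonoid (reesGrading I) where
  one_mem j hj := by
    change (1 : Polynomial R).coeff j = 0
    rw [Polynomial.coeff_one, if_neg hj]
  mul_mem i j f g hf hg k hk := by
    change ((f : Polynomial R) * (g : Polynomial R)).coeff k = 0
    rw [reesGrading_eq_monomial hf, reesGrading_eq_monomial hg, Polynomial.monomial_mul_monomial]
    exact Polynomial.coeff_monomial_of_ne _ hk

theorem coeff_coeAddMonoidHom_reesGrading {R : Type u} [CommRing R] {I : Ideal R}
    (x : DirectSum ℕ fun i => reesGrading I i) (j : ℕ) :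
    (DirectSum.coeAddMonoidHom (reesGrading I) x : Polynomial R).coeff j =
      ((x j : reesAlgebra I) : Polynomial R).coeff j := by
  induction x using DirectSum.induction_on with
  | zero => simp
  | of i f =>
    rw [DirectSum.coeAddMonoidHom_of]
    by_cases h : j = i
    · subst h
      rw [DirectSum.of_eq_same]
    · rw [DirectSum.of_eq_of_ne _ _ _ h]
      simpa using f.2 j h
  | add x y hx hy => simp [hx, hy]

/-- The Rees algebra is graded by the powers of `t`. -/
noncomputable instance reesGrading_gradedRing {R : Type u} [CommRing R] (I : Ideal R) :
    GradedRing (reesGrading I) where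
  decompose' f := DirectSum.mk (fun i => reesGrading I i) (f : Polynomial R).support
    fun i => reesComponent f i
  left_inv f := by
    apply Subtype.ext
    ext j
    rw [coeff_coeAddMonoidHom_reesGrading]
    by_cases h : j ∈ (f : Polynomial R).support
    · rw [DirectSum.mk_apply_of_mem h]
      exact Polynomial.coeff_monomial_same _ _
    · rw [DirectSum.mk_apply_of_notMem h, Polynomial.notMem_support_iff.1 h]
      simp
  right_inv x := by
    refine DFinsupp.ext fun j => ?_
    apply Subtype.ext
    apply Subtype.ext
    rw [reesGrading_eq_monomial (x j).2, ← coeff_coeAddMonoidHom_reesGrading]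
    set f := DirectSum.coeAddMonoidHom (reesGrading I) x
    by_cases h : j ∈ (f : Polynomial R).support
    · erw [DirectSum.mk_apply_of_mem h]
      rfl
    · erw [DirectSum.mk_apply_of_notMem h]
      rw [Polynomial.notMem_support_iff.1 h]
      simp

/-- The blowup of `Spec R` in the ideal `I`, as a scheme: `Proj` of the Rees algebra of `I`. -/
noncomputable abbrev blowup {R : Type u} [CommRing R] (I : Ideal R) : Scheme.{u} :=
  Proj (reesGrading I)

/-- The blowup map `π` from the blowup of `Spec R` in `I` to `Spec R`. -/
noncomputable def blowupMap {R : Type u} [CommRing R] (I : Ideal R) :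
    blowup I ⟶ Spec (CommRingCat.of R) :=
  Proj.toSpecZero (reesGrading I) ≫
    Spec.map (CommRingCat.ofHom (algebraMap R (reesGrading I 0)))

/-! ### Tame monomial ideals -/

/-- An ideal of `K[x₁, …, xₙ]` is a monomial ideal if it is generated by monomials. -/
def IsMonomialIdeal {K : Type u} [Field K] {n : ℕ} (I : Ideal (MvPolynomial (Fin n) K)) : Prop :=
  ∃ A : Set (Fin n →₀ ℕ), I = Ideal.span ((fun a => MvPolynomial.monomial a (1 : K)) '' A)

/-- The structure morphism to `Spec K` of the blowup of affine space `𝔸ⁿ = Spec K[x₁, …, xₙ]`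
in the ideal `I`: the blowup map followed by the projection `𝔸ⁿ ⟶ Spec K`. -/
noncomputable def affineBlowupStructure {K : Type u} [Field K] {n : ℕ}
    (I : Ideal (MvPolynomial (Fin n) K)) : blowup I ⟶ Spec (CommRingCat.of K) :=
  blowupMap I ≫
    Spec.map (CommRingCat.ofHom (algebraMap K (MvPolynomial (Fin n) K)))

/-- A monomial ideal of `K[x₁, …, xₙ]` is tame if the blowup of `𝔸ⁿ` in it is smooth over `K`. -/
structure IsTame {K : Type u} [Field K] {n : ℕ} (I : Ideal (MvPolynomial (Fin n) K)) : Prop where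
  isMonomialIdeal : IsMonomialIdeal I
  smooth : Smooth (affineBlowupStructure I)

/-! ### The ideals of the coordinate axes and of the origin -/

/-- The ideal `⋂_{i ≤ s} (x₁, …, x̂ᵢ, …, xₙ)` of the union of the first `s` coordinate axes
of `𝔸ⁿ`. The coordinates are indexed by `0, …, n - 1`, so the first `s` are those with `i < s`. -/
noncomputable def axesIdeal (K : Type u) [Field K] (n s : ℕ) : Ideal (MvPolynomial (Fin n) K) :=
  ⨅ i : {i : Fin n // (i : ℕ) < s}, Ideal.span (MvPolynomial.X '' {j : Fin n | j ≠ i})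

/-- The ideal `𝔪 = (x₁, …, xₙ)` of the origin of `𝔸ⁿ`. -/
noncomputable def originIdeal (K : Type u) [Field K] (n : ℕ) : Ideal (MvPolynomial (Fin n) K) :=
  Ideal.span (Set.range MvPolynomial.X)

/-- The Rosenberg ideal `R = I ∩ 𝔪³`. -/
noncomputable def rosenbergIdeal (K : Type u) [Field K] (n s : ℕ) : Ideal (MvPolynomial (Fin n) K) :=
  axesIdeal K n s ⊓ originIdeal K n ^ 3

/-! The ideal R is generated by all cubic monomials except x_i³ with i < s
(`rosenbergIdeal_eq_span`). Its Newton polyhedron is that of 𝔪³ with the corners x_i³, i < s, cut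
off. Each cut passes through the monomials x_i² x_k, at distance 1 along edges of length 3, so
different cuts do not meet; with 𝔪² they would meet at x_i x_k. Geometrically, the origin is blown
up first, then the strict transforms of the s axes, which have become disjoint.

Smoothness is checked on the charts of the vertices x_j³ and x_i² x_k. Each is an affine space: a
monomial substitution makes R principal, generated by the image of the vertex f, and every new
coordinate is a quotient of an element of R by a power of f. By `exists_chartEquiv` these two facts
identify the chart with a polynomial ring. The vertex charts cover (`exists_mem_vertexChart`),
because the square of any other generator is a product of two elements of R, one of which leads to a
vertex.

The radical is formal: I is an intersection of primes and lies in 𝔪. -/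

/-! ### Charts of the blowup -/

/-- The element `a t ^ k` of the Rees algebra, for `a ∈ I ^ k`. -/
noncomputable def reesMonomial {R : Type u} [CommRing R] {I : Ideal R} (k : ℕ) (a : R)
    (ha : a ∈ I ^ k) : reesAlgebra I :=
  ⟨Polynomial.monomial k a, reesAlgebra.monomial_mem.2 ha⟩

theorem reesMonomial_mem {R : Type u} [CommRing R] {I : Ideal R} (k : ℕ) (a : R)
    (ha : a ∈ I ^ k) : reesMonomial k a ha ∈ reesGrading I k :=
  fun _ hj => Polynomial.coeff_monomial_of_ne _ hj

theorem exists_eq_reesMonomial {R : Type u} [CommRing R] {I : Ideal R} {k : ℕ}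
    {F : reesAlgebra I} (hF : F ∈ reesGrading I k) : ∃ a ha, F = reesMonomial k a ha :=
  ⟨_, F.2 k, Subtype.ext (reesGrading_eq_monomial hF)⟩

theorem reesMonomial_mul {R : Type u} [CommRing R] {I : Ideal R} {k l : ℕ} {a b : R}
    (ha : a ∈ I ^ k) (hb : b ∈ I ^ l) :
    reesMonomial k a ha * reesMonomial l b hb =
      reesMonomial (k + l) (a * b) (pow_add I k l ▸ Ideal.mul_mem_mul ha hb) :=
  Subtype.ext (Polynomial.monomial_mul_monomial _ _ _ _)

/-- The element `f t` of degree one of the Rees algebra, for `f ∈ I`. -/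
noncomputable def reesT {R : Type u} [CommRing R] {I : Ideal R} (f : R) (hf : f ∈ I) :
    reesAlgebra I :=
  reesMonomial 1 f (by rwa [pow_one])

theorem reesT_mem {R : Type u} [CommRing R] {I : Ideal R} (f : R) (hf : f ∈ I) :
    reesT f hf ∈ reesGrading I 1 :=
  reesMonomial_mem _ _ _

/-- A ring homomorphism on `R`, extended to the Rees algebra by `t ↦ 1`. -/
noncomputable def reesEval {R L : Type u} [CommRing R] [CommRing L] (I : Ideal R) (φ : R →+* L) :
    reesAlgebra I →+* L :=
  (Polynomial.eval₂RingHom φ 1).comp (reesAlgebra I).val.toRingHom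

theorem reesEval_reesMonomial {R L : Type u} [CommRing R] [CommRing L] {I : Ideal R}
    (φ : R →+* L) {k : ℕ} {a : R} (ha : a ∈ I ^ k) : reesEval I φ (reesMonomial k a ha) = φ a := by
  simp [reesEval, reesMonomial]

/-- The fraction `a t ^ k / (f t) ^ k` in the coordinate ring of the chart `D₊(f t)`. -/
noncomputable def chartFrac {R : Type u} [CommRing R] {I : Ideal R} {f : R} (hf : f ∈ I) (k : ℕ)
    (a : R) (ha : a ∈ I ^ k) : HomogeneousLocalization.Away (reesGrading I) (reesT f hf) :=
  HomogeneousLocalization.Away.mk _ (reesT_mem f hf) k (reesMonomial k a ha)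
    (by simpa using reesMonomial_mem k a ha)

theorem exists_eq_chartFrac {R : Type u} [CommRing R] {I : Ideal R} {f : R} (hf : f ∈ I)
    (z : HomogeneousLocalization.Away (reesGrading I) (reesT f hf)) :
    ∃ k a ha, z = chartFrac hf k a ha := by
  obtain ⟨k, F, hF, rfl⟩ := HomogeneousLocalization.Away.mk_surjective _ (reesT_mem f hf) z
  have hF' : F ∈ reesGrading I k := by simpa using hF
  obtain ⟨a, ha, rfl⟩ := exists_eq_reesMonomial hF'
  exact ⟨k, a, ha, rfl⟩

/-- A ring homomorphism `φ` from `R` to a field with `φ f ≠ 0`, extended to the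
coordinate ring of the chart `D₊(f t)` by `a t ^ k / (f t) ^ k ↦ φ a / φ f ^ k`. -/
noncomputable def chartEval {R L : Type u} [CommRing R] [Field L] {I : Ideal R} {f : R}
    (hf : f ∈ I) (φ : R →+* L) (hφ : φ f ≠ 0) :
    HomogeneousLocalization.Away (reesGrading I) (reesT f hf) →+* L :=
  (Localization.awayLift (reesEval I φ) (reesT f hf)
    (by rw [reesT, reesEval_reesMonomial]; exact hφ.isUnit)).comp
    (algebraMap (HomogeneousLocalization.Away (reesGrading I) (reesT f hf))
      (Localization.Away (reesT f hf)))

theorem chartEval_chartFrac {R L : Type u} [CommRing R] [Field L] {I : Ideal R} {f : R}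
    (hf : f ∈ I) (φ : R →+* L) (hφ : φ f ≠ 0) (k : ℕ) (a : R) (ha : a ∈ I ^ k) :
    chartEval hf φ hφ (chartFrac hf k a ha) = φ a / φ f ^ k := by
  have hv : reesEval I φ (reesT f hf) * (φ f)⁻¹ = 1 := by
    rw [reesT, reesEval_reesMonomial, mul_inv_cancel₀ hφ]
  refine (Localization.awayLift_mk (reesEval I φ) (reesT f hf) (reesMonomial k a ha) _ hv k).trans ?_
  rw [reesEval_reesMonomial, inv_pow, div_eq_mul_inv]

/-- Setting t = 1 is not injective on the Rees algebra (it identifies f t with f), but it is on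
degree-zero fractions: such a fraction has a homogeneous numerator a t ^ k, which vanishes as soon
as φ a does. -/
theorem chartEval_injective {R L : Type u} [CommRing R] [Field L] {I : Ideal R} {f : R}
    (hf : f ∈ I) (φ : R →+* L) (hφ : φ f ≠ 0) (hinj : Function.Injective φ) :
    Function.Injective (chartEval hf φ hφ) := by
  rw [injective_iff_map_eq_zero]
  intro z hz
  obtain ⟨k, a, ha, rfl⟩ := exists_eq_chartFrac hf z
  rw [chartEval_chartFrac, div_eq_zero_iff, or_iff_left (pow_ne_zero _ hφ)] at hz
  obtain rfl := (map_eq_zero_iff φ hinj).1 hz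
  have h0 : reesMonomial k (0 : R) ha = 0 := Subtype.ext (Polynomial.monomial_zero_right k)
  refine HomogeneousLocalization.val_injective _ ?_
  rw [chartFrac, HomogeneousLocalization.Away.val_mk, h0, Localization.mk_zero,
    HomogeneousLocalization.val_zero]

/-- The structure map of the chart `D₊(f t)` of the blowup. -/
noncomputable def chartStructure {R : Type u} [CommRing R] {I : Ideal R} {f : R} (hf : f ∈ I) :
    R →+* HomogeneousLocalization.Away (reesGrading I) (reesT f hf) :=
  (HomogeneousLocalization.fromZeroRingHom (reesGrading I) _).comp
    (algebraMap R (reesGrading I 0))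

theorem chartStructure_apply {R : Type u} [CommRing R] {I : Ideal R} {f : R} (hf : f ∈ I) (a : R) :
    chartStructure hf a = chartFrac hf 0 a (by simp) := by
  refine HomogeneousLocalization.val_injective _ ?_
  rw [chartFrac, HomogeneousLocalization.Away.val_mk]
  change Localization.mk _ _ = Localization.mk _ _
  congr 1

theorem awayι_blowupMap {R : Type u} [CommRing R] {I : Ideal R} {f : R} (hf : f ∈ I) :
    Proj.awayι (reesGrading I) (reesT f hf) (reesT_mem f hf) one_pos ≫ blowupMap I =
      Spec.map (CommRingCat.ofHom (chartStructure hf)) := by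
  rw [blowupMap, Proj.awayι_toSpecZero_assoc, ← Spec.map_comp]
  rfl

theorem range_subset_range_of_closure_eq_top {B C L : Type*} [CommRing B] [CommRing C]
    [CommRing L] (f : B →+* L) (g : C →+* L) (G : Set B) (hG : Subring.closure G = ⊤)
    (h : ∀ y ∈ G, f y ∈ Set.range g) : Set.range f ⊆ Set.range g := by
  rintro _ ⟨b, rfl⟩
  have hle : Subring.closure G ≤ g.range.comap f := Subring.closure_le.2 h
  exact hle (hG ▸ Subring.mem_top b)

theorem exists_ringEquiv_of_range_eq {B C L : Type*} [CommRing B] [CommRing C] [CommRing L]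
    (f : B →+* L) (g : C →+* L) (hf : Function.Injective f) (hg : Function.Injective g)
    (h : Set.range f = Set.range g) : ∃ e : B ≃+* C, ∀ b, g (e b) = f b := by
  choose e he using fun b => h ▸ Set.mem_range_self (f := f) b
  let E : B →+* C :=
    { toFun := e
      map_one' := hg (by simp [he])
      map_mul' := fun a b => hg (by simp [he])
      map_zero' := hg (by simp [he])
      map_add' := fun a b => hg (by simp [he]) }
  refine ⟨RingEquiv.ofBijective E ⟨fun a b hab => hf ?_, fun c => ?_⟩, he⟩
  · rw [← he, ← he]
    exact congrArg g hab
  · obtain ⟨b, hb⟩ := h.symm ▸ Set.mem_range_self (f := g) c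
    exact ⟨b, hg ((he b).trans hb)⟩

/-- A chart of a blowup is isomorphic to `Spec B` if the ideal becomes principal in `B` with
generator `f`, and if `B` is generated by quotients `a / f ^ k` with `a ∈ I ^ k`. -/
theorem exists_chartEquiv {R B : Type u} [CommRing R] [CommRing B] [IsDomain B] {I : Ideal R}
    {f : R} (hf : f ∈ I) (ψ : R →+* B) (hψ : Function.Injective ψ) (hf0 : f ≠ 0)
    (hI : ∀ g ∈ I, ψ f ∣ ψ g) (G : Set B) (hG : Subring.closure G = ⊤)
    (hquot : ∀ y ∈ G, ∃ k, ∃ a ∈ I ^ k, ψ a = y * ψ f ^ k) :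
    ∃ e : B ≃+* HomogeneousLocalization.Away (reesGrading I) (reesT f hf),
      ∀ a, e (ψ a) = chartStructure hf a := by
  -- `B` and the chart ring both embed in `L`; it remains to see that their images agree.
  set L := FractionRing B
  set φ : R →+* L := (algebraMap B L).comp ψ
  have hB : Function.Injective (algebraMap B L) := IsFractionRing.injective B L
  have hφ : Function.Injective φ := hB.comp hψ
  have hφf : φ f ≠ 0 := fun h => hf0 ((map_eq_zero_iff φ hφ).1 h)
  have hpow : ∀ k, ∀ a ∈ I ^ k, ψ f ^ k ∣ ψ a := by
    intro k a ha
    have h1 : I.map ψ ≤ Ideal.span {ψ f} :=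
      Ideal.map_le_iff_le_comap.2 fun g hg => Ideal.mem_span_singleton.2 (hI g hg)
    have h2 := Ideal.pow_right_mono h1 k (Ideal.map_pow ψ I k ▸ Ideal.mem_map_of_mem ψ ha)
    rwa [Ideal.span_singleton_pow, Ideal.mem_span_singleton] at h2
  have hrange : Set.range (algebraMap B L) = Set.range (chartEval hf φ hφf) := by
    apply subset_antisymm
    · refine range_subset_range_of_closure_eq_top _ _ G hG fun y hy => ?_
      obtain ⟨k, a, ha, h⟩ := hquot y hy
      refine ⟨chartFrac hf k a ha, ?_⟩
      rw [chartEval_chartFrac, div_eq_iff (pow_ne_zero _ hφf)]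
      simp only [φ, RingHom.comp_apply, h, map_mul, map_pow]
    · rintro _ ⟨z, rfl⟩
      obtain ⟨k, a, ha, rfl⟩ := exists_eq_chartFrac hf z
      obtain ⟨b, hb⟩ := hpow k a ha
      refine ⟨b, ?_⟩
      rw [chartEval_chartFrac, eq_div_iff (pow_ne_zero _ hφf)]
      simp only [φ, RingHom.comp_apply, hb, map_mul, map_pow, mul_comm]
  have hev := chartEval_injective hf φ hφf hφ
  obtain ⟨e, he⟩ := exists_ringEquiv_of_range_eq (algebraMap B L) (chartEval hf φ hφf) hB hev hrange
  refine ⟨e, fun a => hev ?_⟩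
  rw [he, chartStructure_apply, chartEval_chartFrac, pow_zero, div_one]
  rfl

/-- The chart is an affine space over K, compatibly with the structure maps. Constants are quotients
with k = 0, so only the coordinates need a witness in `hquot`. -/
theorem smooth_chartStructure_comp {K : Type u} [Field K] {n : ℕ}
    {R : Type u} [CommRing R] [Algebra K R] {I : Ideal R} {f : R} (hf : f ∈ I)
    (ψ : R →ₐ[K] MvPolynomial (Fin n) K) (hψ : Function.Injective ψ) (hf0 : f ≠ 0)
    (hI : ∀ g ∈ I, ψ f ∣ ψ g)
    (hquot : ∀ j, ∃ k, ∃ a ∈ I ^ k, ψ a = MvPolynomial.X j * ψ f ^ k) :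
    ((chartStructure hf).comp (algebraMap K R)).Smooth := by
  obtain ⟨e, he⟩ := exists_chartEquiv hf (ψ : R →+* MvPolynomial (Fin n) K) hψ hf0 hI
    (Set.range MvPolynomial.C ∪ Set.range MvPolynomial.X)
    (by
      rw [eq_top_iff]
      rintro p -
      induction p using MvPolynomial.induction_on with
      | C a => exact Subring.subset_closure (Or.inl ⟨a, rfl⟩)
      | add p q hp hq => exact add_mem hp hq
      | mul_X p j hp => exact mul_mem hp (Subring.subset_closure (Or.inr ⟨j, rfl⟩)))
    (by
      rintro _ (⟨a, rfl⟩ | ⟨j, rfl⟩)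
      · exact ⟨0, algebraMap K R a, by simp, by simp [MvPolynomial.algebraMap_eq]⟩
      · exact hquot j)
  have h : (chartStructure hf).comp (algebraMap K R) =
      (e : MvPolynomial (Fin n) K →+* _).comp (algebraMap K (MvPolynomial (Fin n) K)) := by
    ext a
    simp only [RingHom.comp_apply, ← he, RingHom.coe_coe, AlgHom.commutes]
  rw [h]
  refine RingHom.Smooth.comp (RingHom.smooth_algebraMap.2 ⟨inferInstance, inferInstance⟩)
    (RingHom.Smooth.of_bijective e.bijective)

/-! ### Covering the blowup by charts -/

/-- The Rees algebra is generated in degree one over degree zero, since I ^ (k + 1) = I ^ k * I, and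
degree one is spanned over R by the g t with g ∈ S. -/
theorem irrelevant_reesGrading_le {R : Type u} [CommRing R] {I : Ideal R} {S : Set R}
    (hS : I = Ideal.span S) (J : Ideal (reesAlgebra I))
    (hJ : ∀ g (hg : g ∈ I), g ∈ S → reesT g hg ∈ J) :
    (HomogeneousIdeal.irrelevant (reesGrading I)).toIdeal ≤ J := by
  classical
  have h1 : ∀ g (hg : g ∈ I), reesT g hg ∈ J := by
    intro g hg
    have hg' : g ∈ Ideal.span S := hS ▸ hg
    induction hg' using Submodule.span_induction with
    | mem g h => exact hJ g hg h
    | zero => convert! J.zero_mem; exact Subtype.ext (Polynomial.monomial_zero_right 1)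
    | add a b ha hb iha ihb =>
      have h := J.add_mem (iha (hS ▸ ha)) (ihb (hS ▸ hb))
      convert! h
      exact Subtype.ext (map_add (Polynomial.monomial 1) a b)
    | smul r a ha iha =>
      convert! J.mul_mem_left (algebraMap R _ r) (iha (hS ▸ ha))
      exact Subtype.ext (by simp [reesT, reesMonomial, Polynomial.C_mul_monomial])
  have h2 : ∀ k, ∀ a (ha : a ∈ I ^ (k + 1)), reesMonomial (k + 1) a ha ∈ J := by
    intro k a ha
    have ha' : a ∈ I ^ k * I := pow_succ I k ▸ ha
    induction ha' using Submodule.mul_induction_on' with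
    | mem_mul_mem b hb c hc =>
      convert! J.mul_mem_left (reesMonomial k b hb) (h1 c hc)
      rw [reesT, reesMonomial_mul]
    | add b hb c hc ihb ihc =>
      convert! J.add_mem (ihb (pow_succ I k ▸ hb)) (ihc (pow_succ I k ▸ hc))
      exact Subtype.ext (map_add (Polynomial.monomial (k + 1)) b c)
  intro F hF
  rw [← DirectSum.sum_support_decompose (reesGrading I) F]
  refine Ideal.sum_mem _ fun k _ => ?_
  rcases k with _ | k
  -- Elements of the irrelevant ideal have no component in degree zero.
  · convert! J.zero_mem
  · obtain ⟨a, ha, h⟩ := exists_eq_reesMonomial (DirectSum.decompose (reesGrading I) F (k + 1)).2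
    rw [h]
    exact h2 k a ha

/-- A point of the blowup in `(S)` lies in one of the charts `D₊(g t)` with `g ∈ S`. -/
theorem exists_mem_basicOpen_reesT {R : Type u} [CommRing R] {I : Ideal R} {S : Set R}
    (hS : I = Ideal.span S) (x : blowup I) :
    ∃ g, ∃ hg : g ∈ I, g ∈ S ∧ x ∈ Proj.basicOpen (reesGrading I) (reesT g hg) := by
  have h := Proj.iSup_basicOpen_eq_top (reesGrading I)
    (fun g : {g // g ∈ I ∧ g ∈ S} => reesT g.1 g.2.1)
    (irrelevant_reesGrading_le hS _ fun g hg hgS => Ideal.subset_span ⟨⟨g, hg, hgS⟩, rfl⟩)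
  obtain ⟨g, hg⟩ := TopologicalSpace.Opens.mem_iSup.1 (h.ge (Set.mem_univ x))
  exact ⟨g.1, g.2.1, g.2.2, hg⟩

theorem basicOpen_le_of_mul_self_eq {A σ : Type*} [CommRing A] [SetLike σ A]
    [AddSubgroupClass σ A] (𝒜 : ℕ → σ) [GradedRing 𝒜] {f g h : A} (H : g * g = f * h) :
    Proj.basicOpen 𝒜 g ≤ Proj.basicOpen 𝒜 f := by
  have h1 := Proj.basicOpen_mono 𝒜 f (g * g) (Dvd.intro h H.symm)
  rwa [Proj.basicOpen_mul, inf_idem] at h1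

/-- If `g² = f h` in `I`, then the chart `D₊(g t)` is contained in the chart `D₊(f t)`. -/
theorem basicOpen_reesT_le {R : Type u} [CommRing R] {I : Ideal R} {f g h : R} (hf : f ∈ I)
    (hg : g ∈ I) (hh : h ∈ I) (H : g * g = f * h) :
    Proj.basicOpen (reesGrading I) (reesT g hg) ≤ Proj.basicOpen (reesGrading I) (reesT f hf) := by
  have h1 : reesT g hg * reesT g hg = reesT f hf * reesT h hh := by
    refine Subtype.ext ?_
    change Polynomial.monomial 1 g * Polynomial.monomial 1 g =
      Polynomial.monomial 1 f * Polynomial.monomial 1 h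
    rw [Polynomial.monomial_mul_monomial, Polynomial.monomial_mul_monomial, H]
  exact basicOpen_le_of_mul_self_eq _ h1

/-- Smoothness of a blowup of affine space can be checked on charts. -/
theorem smooth_affineBlowupStructure {K : Type u} [Field K] {n : ℕ}
    {I : Ideal (MvPolynomial (Fin n) K)} (V : Set (MvPolynomial (Fin n) K))
    (hcover : ∀ x : blowup I, ∃ f, ∃ hf : f ∈ I, f ∈ V ∧
      x ∈ Proj.basicOpen (reesGrading I) (reesT f hf))
    (hV : ∀ f (hf : f ∈ I), f ∈ V →
      ((chartStructure hf).comp (algebraMap K (MvPolynomial (Fin n) K))).Smooth) :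
    Smooth (affineBlowupStructure I) := by
  choose f hf hfV hx using hcover
  let 𝒰 : (blowup I).AffineOpenCover :=
    { I₀ := blowup I
      X := fun x => .of (HomogeneousLocalization.Away (reesGrading I) (reesT (f x) (hf x)))
      f := fun x => Proj.awayι (reesGrading I) _ (reesT_mem (f x) (hf x)) one_pos
      idx := id
      covers := fun x => by
        change x ∈ (Proj.awayι (reesGrading I) _ (reesT_mem (f x) (hf x)) one_pos).opensRange
        rw [Proj.opensRange_awayι]
        exact hx x }
  have : IsZariskiLocalAtSource @Smooth.{u} :=
    HasRingHomProperty.instIsZariskiLocalAtSource (Q := RingHom.Smooth)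
  rw [IsZariskiLocalAtSource.iff_of_openCover (P := @Smooth.{u}) 𝒰.openCover]
  intro x
  change Smooth (Proj.awayι (reesGrading I) _ (reesT_mem (f x) (hf x)) one_pos ≫ _)
  rw [affineBlowupStructure, ← Category.assoc, awayι_blowupMap, ← Spec.map_comp,
    HasRingHomProperty.Spec_iff (P := @Smooth)]
  exact hV _ (hf x) (hfV x)

/-! ### The Rosenberg ideal -/

/-- The cubic monomials other than the cubes of the first `s` variables. -/
def rosenbergCubics (K : Type u) [Field K] (n s : ℕ) : Set (MvPolynomial (Fin n) K) :=
  {g | ∃ a b c : Fin n, ¬(a = b ∧ b = c ∧ (a : ℕ) < s) ∧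
    g = MvPolynomial.X a * MvPolynomial.X b * MvPolynomial.X c}

theorem mem_axesIdeal_iff {K : Type u} [Field K] {n s : ℕ} {p : MvPolynomial (Fin n) K} :
    p ∈ axesIdeal K n s ↔ ∀ m ∈ p.support, ∀ i : Fin n, (i : ℕ) < s → ∃ j ≠ i, m j ≠ 0 := by
  simp only [axesIdeal, Submodule.mem_iInf, MvPolynomial.mem_ideal_span_X_image, Subtype.forall,
    Set.mem_ofPred_eq]
  exact ⟨fun h m hm i hi => h i hi m hm, fun h i hi m hm => h m hm i hi⟩

theorem mem_rosenbergIdeal_iff {K : Type u} [Field K] {n s : ℕ} {p : MvPolynomial (Fin n) K} :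
    p ∈ rosenbergIdeal K n s ↔ ∀ m ∈ p.support,
      (∀ i : Fin n, (i : ℕ) < s → ∃ j ≠ i, m j ≠ 0) ∧ 3 ≤ m.degree := by
  rw [rosenbergIdeal, Submodule.mem_inf, mem_axesIdeal_iff]
  -- `originIdeal` unfolds to the ideal of the variables.
  erw [MvPolynomial.mem_pow_idealOfVars_iff]
  exact ⟨fun h m hm => ⟨h.1 m hm, h.2 m hm⟩, fun h => ⟨fun m hm => (h m hm).1,
    fun m hm => (h m hm).2⟩⟩

theorem exists_add_single_of_degree_pos {σ : Type*} {m : σ →₀ ℕ} (h : 0 < m.degree) :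
    ∃ a m', m = m' + Finsupp.single a 1 ∧ m'.degree + 1 = m.degree := by
  have hm : m ≠ 0 := by rintro rfl; simp at h
  obtain ⟨a, ha⟩ := Finsupp.ne_iff.1 hm
  have hle : Finsupp.single a 1 ≤ m := by
    rw [Finsupp.single_le_iff]
    exact Nat.one_le_iff_ne_zero.2 ha
  refine ⟨a, m - Finsupp.single a 1, (tsub_add_cancel_of_le hle).symm, ?_⟩
  conv_rhs => rw [← tsub_add_cancel_of_le hle, map_add, Finsupp.degree_single]

theorem exists_add_single_of_ne_zero {σ : Type*} {m : σ →₀ ℕ} {a : σ} (ha : m a ≠ 0) :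
    ∃ m', m = m' + Finsupp.single a 1 ∧ m'.degree + 1 = m.degree := by
  have hle : Finsupp.single a 1 ≤ m := by
    rw [Finsupp.single_le_iff]
    exact Nat.one_le_iff_ne_zero.2 ha
  refine ⟨m - Finsupp.single a 1, (tsub_add_cancel_of_le hle).symm, ?_⟩
  conv_rhs => rw [← tsub_add_cancel_of_le hle, map_add, Finsupp.degree_single]

/-- Split off any variable x_c. If c < s, the monomial is not a power of x_c, so some x_b with b ≠ c
can be split off next; if c ≥ s, the factor x_c already rules out a forbidden cube. The remaining
factors are arbitrary. -/
theorem exists_cubic_le {n s : ℕ} {m : Fin n →₀ ℕ}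
    (h : ∀ i : Fin n, (i : ℕ) < s → ∃ j ≠ i, m j ≠ 0) (hm : 3 ≤ m.degree) :
    ∃ (a b c : Fin n) (m' : Fin n →₀ ℕ), ¬(a = b ∧ b = c ∧ (a : ℕ) < s) ∧
      m = m' + Finsupp.single a 1 + Finsupp.single b 1 + Finsupp.single c 1 := by
  obtain ⟨c, m₁, h₁, d₁⟩ := exists_add_single_of_degree_pos (m := m) (by omega)
  by_cases hc : (c : ℕ) < s
  · obtain ⟨b, hb, hb0⟩ := h c hc
    have hb1 : m₁ b ≠ 0 := by
      rw [h₁] at hb0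
      simpa [Finsupp.single_apply, hb.symm] using hb0
    obtain ⟨m₂, h₂, d₂⟩ := exists_add_single_of_ne_zero hb1
    obtain ⟨a, m₃, h₃, -⟩ := exists_add_single_of_degree_pos (m := m₂) (by omega)
    exact ⟨a, b, c, m₃, fun h => hb h.2.1, by rw [h₁, h₂, h₃]⟩
  · obtain ⟨b, m₂, h₂, d₂⟩ := exists_add_single_of_degree_pos (m := m₁) (by omega)
    obtain ⟨a, m₃, h₃, -⟩ := exists_add_single_of_degree_pos (m := m₂) (by omega)
    refine ⟨a, b, c, m₃, ?_, by rw [h₁, h₂, h₃]⟩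
    rintro ⟨rfl, rfl, h⟩
    exact hc h

theorem X_mul_X_mul_X_mem_rosenbergIdeal {K : Type u} [Field K] {n s : ℕ} {a b c : Fin n}
    (h : ¬(a = b ∧ b = c ∧ (a : ℕ) < s)) :
    (MvPolynomial.X a * MvPolynomial.X b * MvPolynomial.X c : MvPolynomial (Fin n) K) ∈
      rosenbergIdeal K n s := by
  refine ⟨?_, ?_⟩
  · simp only [axesIdeal, SetLike.mem_coe, Submodule.mem_iInf]
    rintro ⟨i, hi⟩
    have hX : ∀ j, j ≠ i → (MvPolynomial.X j : MvPolynomial (Fin n) K) ∈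
        Ideal.span (MvPolynomial.X '' {j : Fin n | j ≠ i}) :=
      fun j hj => Ideal.subset_span ⟨j, hj, rfl⟩
    by_cases ha : a = i
    · by_cases hb : b = i
      · refine Ideal.mul_mem_left _ _ (hX c fun hc => h ?_)
        exact ⟨ha.trans hb.symm, hb.trans hc.symm, ha ▸ hi⟩
      · exact Ideal.mul_mem_right _ _ (Ideal.mul_mem_left _ _ (hX b hb))
    · exact Ideal.mul_mem_right _ _ (Ideal.mul_mem_right _ _ (hX a ha))
  · have hX : ∀ j, (MvPolynomial.X j : MvPolynomial (Fin n) K) ∈ originIdeal K n :=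
      fun j => Ideal.subset_span ⟨j, rfl⟩
    rw [SetLike.mem_coe, pow_succ, pow_two]
    exact Ideal.mul_mem_mul (Ideal.mul_mem_mul (hX a) (hX b)) (hX c)

theorem rosenbergIdeal_eq_span (K : Type u) [Field K] (n s : ℕ) :
    rosenbergIdeal K n s = Ideal.span (rosenbergCubics K n s) := by
  apply le_antisymm
  · intro p hp
    rw [mem_rosenbergIdeal_iff] at hp
    rw [p.as_sum]
    refine Ideal.sum_mem _ fun m hm => ?_
    obtain ⟨a, b, c, m', h, e⟩ := exists_cubic_le (hp m hm).1 (hp m hm).2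
    have hmon : MvPolynomial.monomial m (p.coeff m) = MvPolynomial.monomial m' (p.coeff m) *
        (MvPolynomial.X a * MvPolynomial.X b * MvPolynomial.X c) := by
      simp only [MvPolynomial.X, MvPolynomial.monomial_mul, mul_one]
      rw [e]
      simp only [add_assoc]
    rw [hmon]
    exact Ideal.mul_mem_left _ _ (Ideal.subset_span ⟨a, b, c, h, rfl⟩)
  · rw [Ideal.span_le]
    rintro _ ⟨a, b, c, h, rfl⟩
    exact X_mul_X_mul_X_mem_rosenbergIdeal h

theorem isMonomialIdeal_rosenbergIdeal (K : Type u) [Field K] (n s : ℕ) :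
    IsMonomialIdeal (rosenbergIdeal K n s) := by
  refine ⟨{m | ∃ a b c : Fin n, ¬(a = b ∧ b = c ∧ (a : ℕ) < s) ∧
    m = Finsupp.single a 1 + Finsupp.single b 1 + Finsupp.single c 1}, ?_⟩
  rw [rosenbergIdeal_eq_span]
  congr 1
  ext g
  constructor
  · rintro ⟨a, b, c, h, rfl⟩
    exact ⟨_, ⟨a, b, c, h, rfl⟩, by simp [MvPolynomial.X, MvPolynomial.monomial_mul]⟩
  · rintro ⟨_, ⟨a, b, c, h, rfl⟩, rfl⟩
    exact ⟨a, b, c, h, by simp [MvPolynomial.X, MvPolynomial.monomial_mul]⟩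

/-! ### The radical -/

/-- The ideal is the kernel of the endomorphism that kills every variable but x_i, and the target is
a domain. -/
theorem isPrime_span_X_image_ne {K : Type u} [Field K] {σ : Type*} (i : σ) :
    (Ideal.span (MvPolynomial.X '' {j : σ | j ≠ i}) : Ideal (MvPolynomial σ K)).IsPrime := by
  classical
  let φ : MvPolynomial σ K →ₐ[K] MvPolynomial σ K :=
    MvPolynomial.aeval fun l => if l = i then MvPolynomial.X l else 0
  have hsub : ∀ p, p - φ p ∈ Ideal.span (MvPolynomial.X '' {j : σ | j ≠ i}) := by
    intro p
    induction p using MvPolynomial.induction_on with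
    | C a => simp [φ]
    | add p q hp hq =>
      rw [map_add, add_sub_add_comm]
      exact add_mem hp hq
    | mul_X p l hp =>
      have hl : MvPolynomial.X l - φ (MvPolynomial.X l) ∈
          Ideal.span (MvPolynomial.X '' {j : σ | j ≠ i}) := by
        by_cases h : l = i
        · simp [φ, h]
        · have hl : (MvPolynomial.X l : MvPolynomial σ K) ∈
              Ideal.span (MvPolynomial.X '' {j : σ | j ≠ i}) :=
            Ideal.subset_span ⟨l, h, rfl⟩
          simpa [φ, h] using hl
      rw [map_mul, show p * MvPolynomial.X l - φ p * φ (MvPolynomial.X l) =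
        (p - φ p) * MvPolynomial.X l + φ p * (MvPolynomial.X l - φ (MvPolynomial.X l)) by ring]
      exact add_mem (Ideal.mul_mem_right _ _ hp) (Ideal.mul_mem_left _ _ hl)
  have hker : Ideal.span (MvPolynomial.X '' {j : σ | j ≠ i}) = RingHom.ker φ := by
    apply le_antisymm
    · rw [Ideal.span_le]
      rintro _ ⟨l, hl, rfl⟩
      have hl' : l ≠ i := hl
      simp [φ, hl']
    · intro p hp
      simpa [(RingHom.mem_ker).1 hp] using hsub p
  rw [hker]
  exact RingHom.ker_isPrime φ

theorem axesIdeal_isRadical (K : Type u) [Field K] (n s : ℕ) : (axesIdeal K n s).IsRadical := by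
  rintro p ⟨k, hk⟩
  rw [axesIdeal, Submodule.mem_iInf] at hk ⊢
  exact fun i => (isPrime_span_X_image_ne i.1).mem_of_pow_mem k (hk i)

/-- √(I ∩ 𝔪³) = √I ∩ √𝔪 = I, since I is radical and contained in 𝔪. The inclusion needs at least one
axis: an empty intersection would be the whole ring. -/
theorem radical_rosenbergIdeal {K : Type u} [Field K] {n s : ℕ} (hs : 0 < s) (hsn : s < n) :
    (rosenbergIdeal K n s).radical = axesIdeal K n s := by
  have hle : axesIdeal K n s ≤ originIdeal K n :=
    (iInf_le _ (⟨⟨0, hs.trans hsn⟩, hs⟩ : {i : Fin n // (i : ℕ) < s})).trans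
      (Ideal.span_mono (Set.image_subset_range _ _))
  rw [rosenbergIdeal, Ideal.radical_inf, (axesIdeal_isRadical K n s).radical,
    Ideal.radical_pow _ three_ne_zero, inf_eq_left]
  exact hle.trans Ideal.le_radical

/-! ### The charts of the blowup in the Rosenberg ideal -/

open MvPolynomial in
/-- A polynomial map of affine space with a rational left inverse is dominant. -/
theorem aeval_injective_of_fractionRing {K : Type u} [Field K] {σ : Type*}
    (v : σ → MvPolynomial σ K) (w : σ → FractionRing (MvPolynomial σ K))
    (h : ∀ l, aeval w (v l) = algebraMap (MvPolynomial σ K) (FractionRing (MvPolynomial σ K)) (X l)) :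
    Function.Injective (aeval v : MvPolynomial σ K →ₐ[K] MvPolynomial σ K) := by
  have hcomp : (aeval w).comp (aeval v) =
      IsScalarTower.toAlgHom K (MvPolynomial σ K) (FractionRing (MvPolynomial σ K)) := by
    ext l
    simp [h]
  have hinj : Function.Injective ((aeval w).comp (aeval v)) := by
    rw [hcomp]
    exact IsFractionRing.injective (MvPolynomial σ K) (FractionRing (MvPolynomial σ K))
  rw [AlgHom.coe_comp] at hinj
  exact hinj.of_comp

theorem dvd_of_mem_rosenbergIdeal {K B : Type u} [Field K] [CommRing B] [Algebra K B] {n s : ℕ}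
    (ψ : MvPolynomial (Fin n) K →ₐ[K] B) (d : B)
    (h : ∀ a b c : Fin n, ¬(a = b ∧ b = c ∧ (a : ℕ) < s) →
      d ∣ ψ (MvPolynomial.X a) * ψ (MvPolynomial.X b) * ψ (MvPolynomial.X c))
    {g : MvPolynomial (Fin n) K} (hg : g ∈ rosenbergIdeal K n s) : d ∣ ψ g := by
  have hle : rosenbergIdeal K n s ≤ (Ideal.span {d}).comap ψ := by
    rw [rosenbergIdeal_eq_span, Ideal.span_le]
    rintro _ ⟨a, b, c, habc, rfl⟩
    simpa [Ideal.mem_span_singleton] using h a b c habc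
  exact Ideal.mem_span_singleton.1 (hle hg)

open MvPolynomial in
/-- The chart of `x_j³`, with coordinates `x_j` and `x_l / x_j`. -/
theorem smooth_cubeChart {K : Type u} [Field K] {n s : ℕ} {j : Fin n}
    (hf : X j * X j * X j ∈ rosenbergIdeal K n s) :
    ((chartStructure hf).comp (algebraMap K (MvPolynomial (Fin n) K))).Smooth := by
  let ι := algebraMap (MvPolynomial (Fin n) K) (FractionRing (MvPolynomial (Fin n) K))
  have hι : ∀ l, ι (X l) ≠ 0 := fun l =>
    (map_ne_zero_iff ι (IsFractionRing.injective _ _)).2 (X_ne_zero l)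
  -- In the target, `X l` with l ≠ j stands for x_l / x_j. All x_l become multiples of x_j, so every
  -- cubic is divisible by x_j³.
  let v : Fin n → MvPolynomial (Fin n) K := fun l => if l = j then X j else X j * X l
  have hvj : v j = X j := if_pos rfl
  have hv : ∀ l, l ≠ j → v l = X j * X l := fun l hl => if_neg hl
  have hdvd : ∀ l, X j ∣ v l := by
    intro l
    by_cases hl : l = j
    · rw [hl, hvj]
    · rw [hv l hl]
      exact dvd_mul_right _ _
  refine smooth_chartStructure_comp hf (aeval v)
    (aeval_injective_of_fractionRing v
      (fun l => if l = j then ι (X j) else ι (X l) / ι (X j)) fun l => ?_)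
    (by simp [X_ne_zero]) (fun g hg => dvd_of_mem_rosenbergIdeal _ _ (fun a b c _ => ?_) hg)
    fun l => ?_
  · by_cases hl : l = j
    · simp [hl, hvj, ι]
    · simp only [hv l hl, map_mul, aeval_X, if_neg hl, if_true]
      exact mul_div_cancel₀ _ (hι j)
  · simp only [map_mul, aeval_X, hvj]
    exact mul_dvd_mul (mul_dvd_mul (hdvd a) (hdvd b)) (hdvd c)
  · by_cases hl : l = j
    · exact ⟨0, X j, by simp, by simp [hl, hvj]⟩
    -- x_l / x_j = x_j² x_l / x_j³.
    · refine ⟨1, X j * X j * X l, ?_, ?_⟩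
      · rw [pow_one]
        exact X_mul_X_mul_X_mem_rosenbergIdeal fun h => hl h.2.1.symm
      · simp only [map_mul, aeval_X, hvj, hv l hl]
        ring

open MvPolynomial in
/-- The chart of `x_i² x_k`, with coordinates `x_i`, `x_k / x_i` and `x_l / x_k`. -/
theorem smooth_squareChart {K : Type u} [Field K] {n s : ℕ} {i k : Fin n} (hi : (i : ℕ) < s)
    (hki : k ≠ i) (hf : X i * X i * X k ∈ rosenbergIdeal K n s) :
    ((chartStructure hf).comp (algebraMap K (MvPolynomial (Fin n) K))).Smooth := by
  let ι := algebraMap (MvPolynomial (Fin n) K) (FractionRing (MvPolynomial (Fin n) K))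
  have hι : ∀ l, ι (X l) ≠ 0 := fun l =>
    (map_ne_zero_iff ι (IsFractionRing.injective _ _)).2 (X_ne_zero l)
  -- In the target, `X k` stands for x_k / x_i and `X l` for x_l / x_k when l ≠ i, k. The vertex
  -- x_i² x_k becomes `X i ^ 3 * X k`.
  let v : Fin n → MvPolynomial (Fin n) K := fun l =>
    if l = i then X i else if l = k then X i * X k else X i * X k * X l
  have hvi : v i = X i := if_pos rfl
  have hvk : v k = X i * X k := (if_neg hki).trans (if_pos rfl)
  have hv : ∀ l, l ≠ i → l ≠ k → v l = X i * X k * X l :=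
    fun l hl hl' => (if_neg hl).trans (if_neg hl')
  have hdvd' : ∀ l, l ≠ i → X i * X k ∣ v l := by
    intro l hl
    by_cases hl' : l = k
    · rw [hl', hvk]
    · rw [hv l hl hl']
      exact dvd_mul_right _ _
  have hdvd : ∀ l, X i ∣ v l := by
    intro l
    by_cases hl : l = i
    · rw [hl, hvi]
    · exact (dvd_mul_right _ _).trans (hdvd' l hl)
  refine smooth_chartStructure_comp hf (aeval v)
    (aeval_injective_of_fractionRing v
      (fun l => if l = i then ι (X i) else if l = k then ι (X k) / ι (X i) else
        ι (X l) / ι (X k)) fun l => ?_)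
    (by simp [X_ne_zero]) (fun g hg => dvd_of_mem_rosenbergIdeal _ _ (fun a b c habc => ?_) hg)
    fun l => ?_
  · by_cases hl : l = i
    · simp [hl, hvi, ι]
    · by_cases hl' : l = k
      · simp only [hl', hvk, map_mul, aeval_X, if_neg hki, if_true]
        exact mul_div_cancel₀ _ (hι i)
      · simp only [hv l hl hl', map_mul, aeval_X, if_neg hl, if_neg hl', if_neg hki, if_true]
        rw [mul_div_cancel₀ _ (hι i), mul_div_cancel₀ _ (hι k)]
  · simp only [map_mul, aeval_X, hvi, hvk]
    -- As x_i³ is excluded, some factor is not x_i. That factor supplies `X i * X k`, and the other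
    -- two supply `X i` each.
    by_cases ha : a = i
    · by_cases hb : b = i
      · have hc : c ≠ i := fun hc => habc ⟨ha.trans hb.symm, hb.trans hc.symm, ha ▸ hi⟩
        exact mul_dvd_mul (mul_dvd_mul (hdvd a) (hdvd b)) (hdvd' c hc)
      · convert! mul_dvd_mul (mul_dvd_mul (hdvd a) (hdvd' b hb)) (hdvd c) using 1
        ring
    · convert! mul_dvd_mul (mul_dvd_mul (hdvd' a ha) (hdvd b)) (hdvd c) using 1
      ring
  · by_cases hl : l = i
    · exact ⟨0, X i, by simp, by simp [hl, hvi]⟩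
    · by_cases hl' : l = k
      -- x_k / x_i = x_i x_k² / (x_i² x_k).
      · refine ⟨1, X i * X k * X k, ?_, ?_⟩
        · rw [pow_one]
          exact X_mul_X_mul_X_mem_rosenbergIdeal fun h => hki h.1.symm
        · simp only [map_mul, aeval_X, hl', hvi, hvk]
          ring
      -- x_l / x_k = x_i² x_l / (x_i² x_k).
      · refine ⟨1, X i * X i * X l, ?_, ?_⟩
        · rw [pow_one]
          exact X_mul_X_mul_X_mem_rosenbergIdeal fun h => hl h.2.1.symm
        · simp only [map_mul, aeval_X, hvi, hvk, hv l hl hl']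
          ring

open MvPolynomial in
/-- The blowup in the Rosenberg ideal is covered by the charts of the vertices of its
Newton polyhedron. -/
theorem exists_mem_vertexChart {K : Type u} [Field K] {n s : ℕ}
    (x : blowup (rosenbergIdeal K n s)) :
    ∃ f, ∃ hf : f ∈ rosenbergIdeal K n s,
      f ∈ {f : MvPolynomial (Fin n) K | (∃ j, f = X j * X j * X j) ∨
        ∃ i k : Fin n, (i : ℕ) < s ∧ k ≠ i ∧ f = X i * X i * X k} ∧
      x ∈ Proj.basicOpen (reesGrading (rosenbergIdeal K n s)) (reesT f hf) := by
  have hsquare : ∀ i k : Fin n, k ≠ i → ∀ hf : X i * X i * X k ∈ rosenbergIdeal K n s,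
      x ∈ Proj.basicOpen (reesGrading (rosenbergIdeal K n s)) (reesT (X i * X i * X k) hf) →
      ∃ f, ∃ hf : f ∈ rosenbergIdeal K n s,
        f ∈ {f : MvPolynomial (Fin n) K | (∃ j, f = X j * X j * X j) ∨
          ∃ i k : Fin n, (i : ℕ) < s ∧ k ≠ i ∧ f = X i * X i * X k} ∧
        x ∈ Proj.basicOpen (reesGrading (rosenbergIdeal K n s)) (reesT f hf) := by
    intro i k hki hf hx
    by_cases hi : (i : ℕ) < s
    · exact ⟨_, hf, Or.inr ⟨i, k, hi, hki, rfl⟩, hx⟩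
    -- For i ≥ s the corner x_i³ is present and (x_i² x_k)² = x_i³ · x_i x_k².
    · refine ⟨_, X_mul_X_mul_X_mem_rosenbergIdeal (a := i) (b := i) (c := i) fun h => hi h.2.2,
        Or.inl ⟨i, rfl⟩, basicOpen_reesT_le (h := X i * X k * X k) _ hf ?_ ?_ hx⟩
      · exact X_mul_X_mul_X_mem_rosenbergIdeal fun h => hki h.1.symm
      · ring
  have hswap : ∀ {f g : MvPolynomial (Fin n) K} (hf : f ∈ rosenbergIdeal K n s)
      (hg : g ∈ rosenbergIdeal K n s), f = g →
      x ∈ Proj.basicOpen (reesGrading (rosenbergIdeal K n s)) (reesT f hf) →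
      x ∈ Proj.basicOpen (reesGrading (rosenbergIdeal K n s)) (reesT g hg) := by
    rintro f _ hf hg rfl hx
    exact hx
  obtain ⟨_, hg, ⟨a, b, c, h, rfl⟩, hx⟩ :=
    exists_mem_basicOpen_reesT (rosenbergIdeal_eq_span K n s) x
  by_cases hab : a = b
  · subst hab
    by_cases hac : a = c
    · subst hac
      exact ⟨_, hg, Or.inl ⟨a, rfl⟩, hx⟩
    · exact hsquare a c (Ne.symm hac) hg hx
  · have haab := X_mul_X_mul_X_mem_rosenbergIdeal (K := K) (s := s) (a := a) (b := a) (c := b)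
      fun h => hab h.2.1
    have hbba := X_mul_X_mul_X_mem_rosenbergIdeal (K := K) (s := s) (a := b) (b := b) (c := a)
      fun h => hab h.2.1.symm
    by_cases hac : a = c
    · subst hac
      exact hsquare a b (Ne.symm hab) haab (hswap hg haab (by ring) hx)
    · by_cases hbc : b = c
      · subst hbc
        exact hsquare b a hab hbba (hswap hg hbba (by ring) hx)
      -- (x_a x_b x_c)² = (x_a² x_b)(x_c² x_b) for distinct a, b, c.
      · refine hsquare a b (Ne.symm hab) haab (basicOpen_reesT_le (h := X c * X c * X b) _ hg ?_ ?_ hx)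
        · exact X_mul_X_mul_X_mem_rosenbergIdeal fun h => hbc h.2.1.symm
        · ring

theorem isTame_rosenbergIdeal (K : Type u) [Field K] (n s : ℕ) :
    IsTame (rosenbergIdeal K n s) where
  isMonomialIdeal := isMonomialIdeal_rosenbergIdeal K n s
  smooth := by
    refine smooth_affineBlowupStructure _ exists_mem_vertexChart ?_
    rintro _ hf (⟨j, rfl⟩ | ⟨i, k, hi, hki, rfl⟩)
    · exact smooth_cubeChart hf
    · exact smooth_squareChart hi hki hf

theorem mainTheorem5 {K : Type u} [Field K] {n s : ℕ} (hs : 1 < s) (hsn : s < n) :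
    IsTame (rosenbergIdeal K n s) ∧
      PrimeSpectrum.zeroLocus (rosenbergIdeal K n s : Set (MvPolynomial (Fin n) K)) =
        PrimeSpectrum.zeroLocus (axesIdeal K n s : Set (MvPolynomial (Fin n) K)) ∧
      (rosenbergIdeal K n s).radical = axesIdeal K n s := by
  have hrad := radical_rosenbergIdeal (K := K) (zero_lt_one.trans hs) hsn
  refine ⟨isTame_rosenbergIdeal K n s, ?_, hrad⟩
  rw [← hrad, PrimeSpectrum.zeroLocus_radical]
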